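/- Let $a,N$ be integers with $1\le a\le N$, and let $d,b_0,b_1,\ldots,b_{2d}\in\mathbb{N}_0$, where the case $d=b_0=0$, $a=N$ is excluded. For $\boldsymbol{s}=(s_1,\ldots,s_u)\in\mathbb{N}^u$ let $$t^{\star}_{N,a}(\boldsymbol{s})=\sum_{k_1\ge\cdots\ge k_u\ge 0}\frac{1}{(Nk_1+a)^{s_1}\cdots(Nk_u+a)^{s_u}},\qquad t^{\star}_{N,a}(\emptyset)=1.$$ For $u\ge1$ and $\boldsymbol{s}=(s_1,\ldots,s_u)\in(\mathbb{Z}\setminus\{0\})^u$ let $$\widetilde t_{N,a}(\boldsymbol{s})=\lim_{n\to\infty}\ \sum_{n>k_1>\cdots>k_u\ge 0}\frac{\operatorname{sign}(s_1)^{k_1}\cdots\operatorname{sign}(s_u)^{k_u}}{(Nk_1+a)^{|s_1|}\cdots(Nk_u+a)^{|s_u|}}\cdot\frac{\left(\frac{2a}{N}\right)_{k_u}}{k_u!},$$ where $(x)_k=x(x+1)\cdots(x+k-1)$, and let $$\widetilde t^{\,1/2}_{N,a}(\boldsymbol{s})=\sum_{\circ=\text{``}+\text{'' or ``},\text{''}}\left(\tfrac12\right)^{\#\text{pluses}}\,\widetilde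 t_{N,a}(s_1\circ s_2\circ\cdots\circ s_u),$$ where the plus of indices means $s+l=|s|+|l|$ if $sl>0$ and $s+l=-(|s|+|l|)$ if $sl<0$. Write $\overline{s}$ for $-s$, and $\{2\}^{b}$ for $b$ consecutive entries equal to $2$. Let $B$ be the Beta function. Then all the series below converge, and $$t^{\star}_{N,a}(\{2\}^{b_0},3,\{2\}^{b_1},1,\{2\}^{b_2},3,\{2\}^{b_3},1,\ldots,\{2\}^{b_{2d-2}},3,\{2\}^{b_{2d-1}},1,\{2\}^{b_{2d}})$$ $$=\frac{2^{2d+1}N}{B\left(\frac aN,\frac aN\right)}\,\widetilde t^{\,1/2}_{N,a}(\overline{2b_0+2},\overline{2b_1+2},\ldots,\overline{2b_{2d-1}+2},\overline{2b_{2d}+1}).$$ For $d=0$ this reads $t^{\star}_{N,a}(\{2\}^{b_0})=\frac{2N}{B(a/N,a/N)}\,\widetilde t_{N,a}(\overline{2b_0+1})$. -/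

import Mathlib

open Filter Topology

/-- The finite multiple `t`-star sum of level `N`
`∑_{n ≥ k₁ ≥ ⋯ ≥ k_u ≥ 0} 1 / ((N k₁ + a)^{s₁} ⋯ (N k_u + a)^{s_u})`, written as a nested sum;
its value on the empty index is `1`. -/
noncomputable def tStarFin (N a : ℕ) : List ℕ → ℕ → ℝ
  | [], _ => 1
  | s :: t, n =>
      ∑ k ∈ Finset.range (n + 1), 1 / ((N : ℝ) * k + a) ^ s * tStarFin N a t k

/-- The series defining `t⋆_{N,a}(s)` converges. All its terms are nonnegative, so this is the same
as convergence of its partial sums over `k₁ ≤ n`. -/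
def TStarConverges (N a : ℕ) (s : List ℕ) : Prop :=
  ∃ L : ℝ, Tendsto (tStarFin N a s) atTop (𝓝 L)

/-- The multiple `t`-star value of level `N`,
`t⋆_{N,a}(s) = ∑_{k₁ ≥ ⋯ ≥ k_u ≥ 0} 1 / ((N k₁ + a)^{s₁} ⋯ (N k_u + a)^{s_u})`. -/
noncomputable def tStar (N a : ℕ) (s : List ℕ) : ℝ :=
  limUnder atTop (tStarFin N a s)

/-- The truncated alternating sum
`∑_{n > k₁ > ⋯ > k_u ≥ 0}
  (∏ᵢ sign(sᵢ)^{kᵢ} / (N kᵢ + a)^{|sᵢ|}) * (2a/N)_{k_u} / k_u!`,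
written as a nested sum, where `(x)_k` is the rising Pochhammer symbol. Only nonempty indices
matter; the value on the empty index is a convention. -/
noncomputable def tTildeFin (N a : ℕ) : List ℤ → ℕ → ℝ
  | [], _ => 1
  | [s], n =>
      ∑ k ∈ Finset.range n,
        (s.sign : ℝ) ^ k / ((N : ℝ) * k + a) ^ s.natAbs *
          ((ascPochhammer ℝ k).eval (2 * (a : ℝ) / N) / (k.factorial : ℝ))
  | s :: l :: t, n =>
      ∑ k ∈ Finset.range n,
        (s.sign : ℝ) ^ k / ((N : ℝ) * k + a) ^ s.natAbs * tTildeFin N a (l :: t) k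

/-- The series defining `t̃_{N,a}(s)` converges, as the limit of its partial sums over `k₁ < n`. -/
def TTildeConverges (N a : ℕ) (s : List ℤ) : Prop :=
  ∃ L : ℝ, Tendsto (tTildeFin N a s) atTop (𝓝 L)

/-- The alternating multiple `t`-value of level `N` containing factorial and Pochhammer symbols,
`t̃_{N,a}(s) = ∑_{k₁ > ⋯ > k_u ≥ 0}
  (∏ᵢ sign(sᵢ)^{kᵢ} / (N kᵢ + a)^{|sᵢ|}) * (2a/N)_{k_u} / k_u!`. -/
noncomputable def tTilde (N a : ℕ) (s : List ℤ) : ℝ :=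
  limUnder atTop (tTildeFin N a s)

/-- The signed addition of indices: absolute values add and signs multiply. -/
def signedAdd (s l : ℤ) : ℤ :=
  if 0 < s * l then |s| + |l| else -(|s| + |l|)

/-- All ways of replacing each `∘` in `s ∘ l₁ ∘ ⋯ ∘ l_m` by a comma or by a (signed) plus: each
choice is listed as the pair of its number of pluses and the resulting index. -/
def plusCommaChoices : ℤ → List ℤ → List (ℕ × List ℤ)
  | s, [] => [(0, [s])]
  | s, l :: t =>
      (plusCommaChoices l t).map (fun p => (p.1, s :: p.2)) ++
        (plusCommaChoices (signedAdd s l) t).map (fun p => (p.1 + 1, p.2))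

/-- The choices of commas and pluses for a nonempty index (there is none for the empty one). -/
def indexChoices : List ℤ → List (ℕ × List ℤ)
  | [] => []
  | s :: t => plusCommaChoices s t

/-- The interpolated alternating multiple `t`-value of level `N`,
`t̃^r_{N,a}(s₁, …, s_u) = ∑_{∘ = "+" or ","} r^{#pluses} t̃_{N,a}(s₁ ∘ ⋯ ∘ s_u)`. -/
noncomputable def tTildeInterp (N a : ℕ) (r : ℝ) (s : List ℤ) : ℝ :=
  ((indexChoices s).map (fun p => r ^ p.1 * tTilde N a p.2)).sum

/-- All the series occurring in `t̃^r_{N,a}(s)` converge. -/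
def TTildeInterpConverges (N a : ℕ) (s : List ℤ) : Prop :=
  ∀ p ∈ indexChoices s, TTildeConverges N a p.2

/-- The index `({2}^{b₀}, c₁, {2}^{b₁}, …, c_m, {2}^{b_m})`. -/
def blocksOfTwos : List ℕ → (ℕ → ℕ) → List ℕ
  | [], b => List.replicate (b 0) 2
  | c :: cs, b => List.replicate (b 0) 2 ++ c :: blocksOfTwos cs (fun i => b (i + 1))

/-- The pattern `{3, 1}^d`. -/
def pattern31 (d : ℕ) : List ℕ := (List.replicate d [3, 1]).flatten

/-- The index `(-(2b₀+2), -(2b₁+2), …, -(2b_{2d-1}+2), -(2b_{2d}+1))`, a bar being a minus sign;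
for `d = 0` it is `(-(2b₀+1))`. -/
def barIndex31 (d : ℕ) (b : ℕ → ℕ) : List ℤ :=
  (List.range (2 * d)).map (fun i => -(2 * (b i : ℤ) + 2)) ++ [-(2 * (b (2 * d) : ℤ) + 1)]

/-!
Write `x_k = N k + a`, `α = a / N` and `p_k = (2α)_k / k!`. The proof truncates the star sum at `n`
and expresses it exactly through the summands of the right-hand side. Let

  `L(n, k) = N c_n n! (2α)_{n+1} / ((n-k)! (2α)_{n+k+1})`,  `c_n = 2 (α)_{n+1}² / (n! (2α)_{n+1})`,

and say that `f` is the transform of `g` if `f n = ∑_{k ≤ n} L(n, k) g k`. The three operations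
`f ↦ (n ↦ ∑_{m ≤ n} f m / x_m ^ s)` that build up the star sum act on `g` in a simple way:

* `s = 2`: `g` is divided by `x_k²`, by a recurrence of `L` in `n` (`isTransform_weight_two`);
* `s = 1`: `g` becomes `(g k + 2 ∑_{j < k} g j) / x_k`, by a recurrence of `L` in `k` and summation
  by parts (`isTransform_weight_one`);
* `s = 3`: this combines division by `x_k²` with the inverse of the operator that occurs for
  `s = 1`, and that inverse is its conjugate by the signs `(-1)^k` (`isTransform_weight_three`).

The empty star sum `1` is the transform of `(-1)^k p_k / x_k` (`isTransform_one`), so by induction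
the star sum for `({2}^{b₀}, 3, {2}^{b₁}, 1, …)` is the transform of a nested alternating sum in
which each `k_i > k_{i+1}` counts twice and each `k_i = k_{i+1}` once (`isTransform_pattern31`). Up
to the factor `2 ^ (2d)` this is the interpolation at `1/2` (`sum_interpSummand`).

Finally `c_n → 2 / B(α, α)` by the limit formula for the Gamma function, while `L(n, k) / (N c_n)`
decreases in `k` from `1` to `0` and tends to `1` as `n → ∞`, so the weighted sums converge to the
unweighted, possibly conditionally convergent, ones (`tendsto_weighted_sum`). In the alternating
sums the outer summations converge absolutely once the innermost one has bounded partial sums, which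
holds because `p_k / x_k` is decreasing; it tends to `0` unless `a = N`.
-/

namespace MultipleT

/-! ### The kernel and its recurrences -/

/-- The arithmetic progression `N k + a` of denominators. -/
noncomputable def node (N a k : ℕ) : ℝ := (N : ℝ) * k + a

/-- The quotient `(2a/N)_k / k!`. -/
noncomputable def pochRatio (N a k : ℕ) : ℝ :=
  (ascPochhammer ℝ k).eval (2 * (a : ℝ) / N) / (k.factorial : ℝ)

/-- The quotient `n! (2α)_{n+1} / ((n-k)! (2α)_{n+k+1})` with `α = a/N`, as a product that
vanishes for `k > n`. -/
noncomputable def kernelRatio (N a n k : ℕ) : ℝ :=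
  ∏ i ∈ Finset.range k, ((n : ℝ) - i) / (2 * (a : ℝ) / N + n + 1 + i)

/-- The constant `2 (α)_{n+1}² / (n! (2α)_{n+1})` with `α = a/N`, which tends to `2 / B(α, α)`. -/
noncomputable def kernelConst (N a n : ℕ) : ℝ :=
  2 * (∏ i ∈ Finset.range (n + 1), ((a : ℝ) / N + i)) ^ 2 /
    ((n.factorial : ℝ) * ∏ i ∈ Finset.range (n + 1), (2 * (a : ℝ) / N + i))

/-- The kernel of the transform; up to the factor `(-1)^k (2α)_k / (k! (N k + a))` it is the
coefficient of `(1 - x / (N k + a)²)⁻¹` in the partial fraction expansion of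
`∏_{j ≤ n} (1 - x / (N j + a)²)⁻¹`. -/
noncomputable def kernel (N a n k : ℕ) : ℝ :=
  N * kernelConst N a n * kernelRatio N a n k

variable {N a : ℕ}

lemma node_pos (ha : 1 ≤ a) (k : ℕ) : 0 < node N a k := by
  have : (1 : ℝ) ≤ a := by exact_mod_cast ha
  unfold node; positivity

lemma pochRatio_succ (k : ℕ) :
    pochRatio N a (k + 1) = pochRatio N a k * ((2 * (a : ℝ) / N + k) / (k + 1)) := by
  have h : (k.factorial : ℝ) ≠ 0 := by positivity
  simp only [pochRatio, ascPochhammer_succ_eval, Nat.factorial_succ]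
  push_cast
  field_simp

lemma kernelRatio_succ (n k : ℕ) :
    kernelRatio N a n (k + 1) =
      kernelRatio N a n k * (((n : ℝ) - k) / (2 * (a : ℝ) / N + n + 1 + k)) := by
  rw [kernelRatio, Finset.prod_range_succ, kernelRatio]

lemma kernelRatio_eq_zero {n k : ℕ} (h : n < k) : kernelRatio N a n k = 0 :=
  Finset.prod_eq_zero (Finset.mem_range.2 h) (by simp)

lemma kernelRatio_succ_mul (ha : 1 ≤ a) (n k : ℕ) :
    kernelRatio N a n (k + 1) * (2 * (a : ℝ) / N + n + 1 + k) =
      kernelRatio N a n k * ((n : ℝ) - k) := by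
  have : (0 : ℝ) < 2 * (a : ℝ) / N + n + 1 + k := by positivity
  rw [kernelRatio_succ]
  field_simp

lemma kernelRatio_succ_left (ha : 1 ≤ a) (n k : ℕ) :
    kernelRatio N a (n + 1) k * ((n + 1 - k) * (2 * (a : ℝ) / N + n + 1 + k)) =
      kernelRatio N a n k * ((n + 1) * (2 * (a : ℝ) / N + n + 1)) := by
  induction k with
  | zero => simp [kernelRatio]
  | succ k ih =>
    have h1 := kernelRatio_succ_mul (N := N) ha (n + 1) k
    have h2 := kernelRatio_succ_mul (N := N) ha n k
    have h3 : (0 : ℝ) < 2 * (a : ℝ) / N + n + 1 + k := by positivity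
    push_cast at h1 ⊢
    apply mul_right_cancel₀ h3.ne'
    linear_combination (n - k) * (2 * (a : ℝ) / N + n + 1 + k) * h1 +
      (n - k) * ih - (n + 1) * (2 * (a : ℝ) / N + n + 1) * h2

lemma kernelConst_succ (ha : 1 ≤ a) (haN : a ≤ N) (n : ℕ) :
    kernelConst N a n * ((a : ℝ) / N + (n + 1)) ^ 2 =
      kernelConst N a (n + 1) * ((n + 1) * (2 * (a : ℝ) / N + n + 1)) := by
  have hN : (0 : ℝ) < N := by exact_mod_cast ha.trans haN
  have ha' : (0 : ℝ) < a := by exact_mod_cast ha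
  have h1 : 0 < ∏ i ∈ Finset.range (n + 1), (2 * (a : ℝ) / N + i) :=
    Finset.prod_pos fun i _ => by positivity
  have h2 : (0 : ℝ) < n.factorial := by positivity
  have h3 : (0 : ℝ) < 2 * (a : ℝ) / N + n + 1 := by positivity
  have h4 : (0 : ℝ) < n + 1 := by positivity
  unfold kernelConst
  rw [Finset.prod_range_succ _ (n + 1), Finset.prod_range_succ _ (n + 1), Nat.factorial_succ]
  set P := ∏ i ∈ Finset.range (n + 1), (2 * (a : ℝ) / N + i)
  set Q := ∏ i ∈ Finset.range (n + 1), ((a : ℝ) / N + i)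
  push_cast
  rw [← add_assoc (2 * (a : ℝ) / N)]
  set z := 2 * (a : ℝ) / N + n + 1
  set w := (a : ℝ) / N
  field_simp

/-- This recurrence in `n` makes division by `(N k + a)²` under the transform correspond to
summation with weight `(N n + a)⁻²`. -/
lemma kernel_recurrence (ha : 1 ≤ a) (haN : a ≤ N) (n k : ℕ) :
    kernel N a n k * node N a (n + 1) ^ 2 =
      kernel N a (n + 1) k * (node N a (n + 1) ^ 2 - node N a k ^ 2) := by
  have hN : (0 : ℝ) < N := by exact_mod_cast ha.trans haN
  have h1 := kernelRatio_succ_left (N := N) ha n k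
  have h2 := kernelConst_succ ha haN n
  have e1 : node N a (n + 1) = N * ((a : ℝ) / N + (n + 1)) := by
    unfold node; push_cast; field_simp; ring
  have e2 : node N a (n + 1) ^ 2 - node N a k ^ 2 =
      N ^ 2 * ((n + 1 - k) * (2 * (a : ℝ) / N + n + 1 + k)) := by
    unfold node; push_cast; field_simp; ring
  rw [e2, e1]
  unfold kernel
  linear_combination N ^ 3 * kernelRatio N a n k * h2 -
    N ^ 3 * kernelConst N a (n + 1) * h1

lemma kernel_eq_zero {n k : ℕ} (h : n < k) : kernel N a n k = 0 := by
  simp [kernel, kernelRatio_eq_zero h]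

/-- The recurrence of the kernel `L` in `k`: the differences of `(x_n - x_k) L(n, k)`, where
`x_k = N k + a`, are `-2 x_k L(n, k)`. -/
lemma kernel_succ_mul_node (ha : 1 ≤ a) (haN : a ≤ N) (n k : ℕ) :
    2 * (node N a (k + 1) * kernel N a n (k + 1)) =
      (node N a n - node N a k) * kernel N a n k -
        (node N a n - node N a (k + 1)) * kernel N a n (k + 1) := by
  have hN : (0 : ℝ) < N := by exact_mod_cast ha.trans haN
  have h := kernelRatio_succ_mul (N := N) ha n k
  have e : (2 * (a : ℝ) / N) * N = 2 * a := by field_simp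
  unfold kernel node
  push_cast
  linear_combination N ^ 2 * kernelConst N a n * h -
    N * kernelConst N a n * kernelRatio N a n (k + 1) * e

/-! ### Multiple star sums as transforms -/

/-- `f` is the transform of `g` by the kernel. -/
def IsTransform (N a : ℕ) (f g : ℕ → ℝ) : Prop :=
  ∀ n, f n = ∑ k ∈ Finset.range (n + 1), kernel N a n k * g k

/-- Summation on the side of `f` is division by `(N k + a)²` on the side of `g`. -/
lemma isTransform_sum (ha : 1 ≤ a) (haN : a ≤ N) {F h : ℕ → ℝ}
    (H : IsTransform N a (fun m => F m * node N a m ^ 2) h) :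
    IsTransform N a (fun n => ∑ m ∈ Finset.range (n + 1), F m)
      (fun k => h k / node N a k ^ 2) := by
  intro n
  induction n with
  | zero =>
    have h0 := H 0
    have hp := node_pos (N := N) ha 0
    simp only [zero_add, Finset.range_one, Finset.sum_singleton] at h0 ⊢
    field_simp
    exact h0
  | succ n ih =>
    have hp := node_pos (N := N) ha (n + 1)
    have hF : F (n + 1) = ∑ k ∈ Finset.range (n + 1 + 1),
        kernel N a (n + 1) k * h k / node N a (n + 1) ^ 2 := by
      rw [← Finset.sum_div, ← H (n + 1)]
      field_simp
    have hz : ∑ k ∈ Finset.range (n + 1), kernel N a n k * (h k / node N a k ^ 2) =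
        ∑ k ∈ Finset.range (n + 1 + 1), kernel N a n k * (h k / node N a k ^ 2) := by
      rw [Finset.sum_range_succ _ (n + 1), kernel_eq_zero (Nat.lt_succ_self n)]; simp
    simp only at ih ⊢
    rw [Finset.sum_range_succ, ih, hF, hz, ← Finset.sum_add_distrib]
    refine Finset.sum_congr rfl fun k _ => ?_
    have hk := node_pos (N := N) ha k
    have e := kernel_recurrence ha haN n k
    field_simp
    linear_combination h k * e

lemma isTransform_weight_two (ha : 1 ≤ a) (haN : a ≤ N) {f g : ℕ → ℝ}
    (H : IsTransform N a f g) :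
    IsTransform N a (fun n => ∑ m ∈ Finset.range (n + 1), 1 / node N a m ^ 2 * f m)
      (fun k => g k / node N a k ^ 2) := by
  apply isTransform_sum ha haN
  intro m
  have hp := node_pos (N := N) ha m
  rw [← H m]
  field_simp

/-- Multiplying the transform by `N n + a` amounts to replacing `g` by
`(N k + a) (g k + 2 ∑_{j < k} g j)`. -/
lemma isTransform_mul_node (ha : 1 ≤ a) (haN : a ≤ N) {f g : ℕ → ℝ}
    (H : IsTransform N a f g) :
    IsTransform N a (fun n => f n * node N a n)
      (fun k => node N a k * (g k + 2 * ∑ j ∈ Finset.range k, g j)) := by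
  intro n
  -- summation by parts, for the partial sums over `k < m`
  have key : ∀ m, ∑ k ∈ Finset.range (m + 1),
      kernel N a n k * (node N a k * (g k + 2 * ∑ j ∈ Finset.range k, g j)) +
        (node N a n - node N a m) * kernel N a n m * ∑ k ∈ Finset.range (m + 1), g k =
      ∑ k ∈ Finset.range (m + 1), kernel N a n k * g k * node N a n := by
    intro m
    induction m with
    | zero => simp; ring
    | succ m ih =>
      have e := kernel_succ_mul_node ha haN n m
      rw [Finset.sum_range_succ _ (m + 1),
        Finset.sum_range_succ (fun k => kernel N a n k * g k * node N a n) (m + 1), ← ih,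
        Finset.sum_range_succ g (m + 1)]
      linear_combination (∑ k ∈ Finset.range (m + 1), g k) * e
  have := key n
  simp only [sub_self, zero_mul, add_zero] at this
  rw [this, ← Finset.sum_mul, ← H n]

lemma isTransform_weight_one (ha : 1 ≤ a) (haN : a ≤ N) {f g : ℕ → ℝ}
    (H : IsTransform N a f g) :
    IsTransform N a (fun n => ∑ m ∈ Finset.range (n + 1), 1 / node N a m ^ 1 * f m)
      (fun k => 1 / node N a k * (g k + 2 * ∑ j ∈ Finset.range k, g j)) := by
  have H1 : IsTransform N a (fun m => (1 / node N a m ^ 1 * f m) * node N a m ^ 2)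
      (fun k => node N a k * (g k + 2 * ∑ j ∈ Finset.range k, g j)) := by
    convert isTransform_mul_node ha haN H using 2 with m
    have hp := node_pos (N := N) ha m
    field_simp
  convert isTransform_sum ha haN H1 using 2 with k
  have hp := node_pos (N := N) ha k
  field_simp

/-- The operator `u ↦ (j ↦ u j + 2 ∑_{k < j} u k)` and its conjugate by the signs `(-1)^k` are inverse
to each other. -/
lemma alternating_double_sum_inverse (v : ℕ → ℝ) (j : ℕ) :
    (-1) ^ j * (v j + 2 * ∑ k ∈ Finset.range j, v k) +
      2 * ∑ k ∈ Finset.range j, (-1) ^ k * (v k + 2 * ∑ i ∈ Finset.range k, v i) =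
      (-1) ^ j * v j := by
  have h : ∀ j, ∑ k ∈ Finset.range j, (-1) ^ k * (v k + 2 * ∑ i ∈ Finset.range k, v i) =
      -((-1) ^ j * ∑ k ∈ Finset.range j, v k) := by
    intro j
    induction j with
    | zero => simp
    | succ j ih => rw [Finset.sum_range_succ, ih, Finset.sum_range_succ, pow_succ]; ring
  rw [h]; ring

lemma isTransform_weight_three (ha : 1 ≤ a) (haN : a ≤ N) {f g v : ℕ → ℝ}
    (H : IsTransform N a f g) (hv : ∀ k, v k = (-1) ^ k * g k / node N a k) :
    IsTransform N a (fun n => ∑ m ∈ Finset.range (n + 1), 1 / node N a m ^ 3 * f m)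
      (fun k => (-1) ^ k / node N a k ^ 2 * (v k + 2 * ∑ j ∈ Finset.range k, v j)) := by
  set h : ℕ → ℝ := fun k => (-1) ^ k * (v k + 2 * ∑ j ∈ Finset.range k, v j) with hh
  have H1 : IsTransform N a (fun m => (1 / node N a m ^ 3 * f m) * node N a m ^ 2) h := by
    -- it suffices to compare after multiplication by `node N a m`
    have H2 := isTransform_mul_node ha haN
      (f := fun m => ∑ k ∈ Finset.range (m + 1), kernel N a m k * h k) (g := h) fun _ => rfl
    intro m
    have hp := node_pos (N := N) ha m
    have e : ∑ k ∈ Finset.range (m + 1), kernel N a m k * h k * node N a m = f m := by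
      refine (Finset.sum_mul ..).symm.trans ((H2 m).trans ?_)
      rw [H m]
      refine Finset.sum_congr rfl fun k _ => ?_
      have hk := node_pos (N := N) ha k
      change kernel N a m k * (node N a k * ((-1) ^ k * (v k + 2 * ∑ j ∈ Finset.range k, v j) +
        2 * ∑ j ∈ Finset.range k, (-1) ^ j * (v j + 2 * ∑ i ∈ Finset.range j, v i))) = _
      rw [alternating_double_sum_inverse, hv]
      have s : ((-1 : ℝ) ^ k) * (-1) ^ k = 1 := by rw [← mul_pow]; simp
      field_simp
      linear_combination kernel N a m k * g k * s
    rw [← Finset.sum_mul] at e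
    change 1 / node N a m ^ 3 * f m * node N a m ^ 2 = _
    rw [← e]
    field_simp
  convert isTransform_sum ha haN H1 using 2 with k
  rw [hh]; ring

/-- The constant sequence `1`. With `m = n + 1`, the recurrence reduces the claim to the vanishing
of `∑_{k ≤ m} (-1)^k (N k + a) (2α)_k / k! L(m, k)`, a well-poised sum that telescopes. -/
lemma isTransform_one (ha : 1 ≤ a) (haN : a ≤ N) :
    IsTransform N a (fun _ => 1) (fun k => (-1) ^ k / node N a k * pochRatio N a k) := by
  have hN : (0 : ℝ) < N := by exact_mod_cast ha.trans haN
  have ha' : (0 : ℝ) < a := by exact_mod_cast ha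
  intro n
  induction n with
  | zero =>
    simp [kernel, kernelConst, kernelRatio, node, pochRatio]
    field_simp
  | succ n ih =>
    have tele : ∀ m, ∑ k ∈ Finset.range (m + 1),
        (-1) ^ k * (node N a k * pochRatio N a k * kernelRatio N a (n + 1) k) =
        (-1) ^ m * (N * (2 * (a : ℝ) / N + m) * (n + 1 - m) / (2 * (n + 1))) *
          (pochRatio N a m * kernelRatio N a (n + 1) m) := by
      intro m
      induction m with
      | zero => simp [node, kernelRatio, pochRatio]; field_simp
      | succ m ihm =>
        have h1 : (2 * (a : ℝ) / N + m) * pochRatio N a m = (m + 1) * pochRatio N a (m + 1) := by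
          rw [pochRatio_succ]; field_simp
        have h2 := kernelRatio_succ_mul (N := N) ha (n + 1) m
        have e : (2 * (a : ℝ) / N) * N = 2 * a := by field_simp
        have e3 : (-1) ^ m * (N * (2 * (a : ℝ) / N + m) * (n + 1 - m) / (2 * (n + 1))) *
            (pochRatio N a m * kernelRatio N a (n + 1) m) =
            (-1) ^ m * (N / (2 * (n + 1))) * ((m + 1) * pochRatio N a (m + 1)) *
            (kernelRatio N a (n + 1) (m + 1) * (2 * (a : ℝ) / N + (n + 1 : ℕ) + 1 + m)) := by
          rw [h2, ← h1]; push_cast; ring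
        rw [Finset.sum_range_succ, ihm, e3]
        unfold node
        push_cast
        set z := 2 * (a : ℝ) / N
        rw [show (a : ℝ) = z * N / 2 by linarith, pow_succ]
        field_simp
        ring
    have hz := tele (n + 1)
    push_cast at hz
    simp only [sub_self, mul_zero, zero_div, zero_mul] at hz
    have hz2 : ∑ k ∈ Finset.range (n + 1), kernel N a n k * ((-1) ^ k / node N a k *
        pochRatio N a k) = ∑ k ∈ Finset.range (n + 1 + 1), kernel N a n k * ((-1) ^ k / node N a k *
        pochRatio N a k) := by
      rw [Finset.sum_range_succ _ (n + 1), kernel_eq_zero (Nat.lt_succ_self n)]; simp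
    have hp := node_pos (N := N) ha (n + 1)
    rw [ih, hz2]
    have : ∀ k, kernel N a n k * ((-1) ^ k / node N a k * pochRatio N a k) =
        kernel N a (n + 1) k * ((-1) ^ k / node N a k * pochRatio N a k) -
        N * kernelConst N a (n + 1) / node N a (n + 1) ^ 2 *
          ((-1) ^ k * (node N a k * pochRatio N a k * kernelRatio N a (n + 1) k)) := by
      intro k
      have hk := node_pos (N := N) ha k
      have e := kernel_recurrence ha haN n k
      have e' : kernel N a n k = kernel N a (n + 1) k *
          (node N a (n + 1) ^ 2 - node N a k ^ 2) / node N a (n + 1) ^ 2 := by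
        rw [← e]; field_simp
      rw [e']
      unfold kernel
      field_simp
    simp only [this, Finset.sum_sub_distrib, ← Finset.mul_sum, hz]
    simp

/-! ### The interpolated sums -/

/-- The nested summand of the interpolated sum with `r = 1/2`, scaled by a power of two: between
two consecutive entries a strict inequality has weight `2` and an equality has weight `1`. -/
noncomputable def interpSummand (N a : ℕ) : List ℤ → ℕ → ℝ
  | [], _ => 0
  | [s], k => (s.sign : ℝ) ^ k / node N a k ^ s.natAbs * pochRatio N a k
  | s :: l :: t, k => (s.sign : ℝ) ^ k / node N a k ^ s.natAbs *
      (interpSummand N a (l :: t) k + 2 * ∑ j ∈ Finset.range k, interpSummand N a (l :: t) j)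

lemma tTildeFin_singleton (s : ℤ) (n : ℕ) :
    tTildeFin N a [s] n =
      ∑ k ∈ Finset.range n, (s.sign : ℝ) ^ k / node N a k ^ s.natAbs * pochRatio N a k := by
  simp only [tTildeFin, node, pochRatio]

lemma tTildeFin_cons (s : ℤ) {q : List ℤ} (hq : q ≠ []) (n : ℕ) :
    tTildeFin N a (s :: q) n =
      ∑ k ∈ Finset.range n, (s.sign : ℝ) ^ k / node N a k ^ s.natAbs * tTildeFin N a q k := by
  cases q with
  | nil => exact absurd rfl hq
  | cons l t => simp only [tTildeFin, node]

lemma plusCommaChoices_ne_nil (t : List ℤ) :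
    ∀ (s : ℤ), ∀ p ∈ plusCommaChoices s t, p.2 ≠ [] := by
  induction t with
  | nil => intro s p hp; simp [plusCommaChoices] at hp; simp [hp]
  | cons l t ih =>
    intro s p hp
    simp only [plusCommaChoices, List.mem_append, List.mem_map] at hp
    rcases hp with ⟨q, _, rfl⟩ | ⟨q, hq, rfl⟩
    · simp
    · exact ih _ q hq

lemma natAbs_signedAdd (s l : ℤ) : (signedAdd s l).natAbs = s.natAbs + l.natAbs := by
  unfold signedAdd
  rw [Int.abs_eq_natAbs, Int.abs_eq_natAbs]
  split_ifs <;> omega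

lemma sign_signedAdd {s l : ℤ} (hs : s ≠ 0) (hl : l ≠ 0) :
    (signedAdd s l).sign = s.sign * l.sign := by
  have : 0 < |s| + |l| := by positivity
  unfold signedAdd
  rw [← Int.sign_mul]
  split_ifs with h
  · rw [Int.sign_eq_one_of_pos this, Int.sign_eq_one_of_pos h]
  · have : s * l < 0 := lt_of_le_of_ne (not_lt.1 h) (mul_ne_zero hs hl)
    rw [Int.sign_eq_neg_one_of_neg this, Int.sign_eq_neg_one_of_neg (by linarith)]

lemma interpSummand_signedAdd {s l : ℤ} (hs : s ≠ 0) (hl : l ≠ 0) (t : List ℤ) (k : ℕ) :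
    interpSummand N a (signedAdd s l :: t) k =
      (s.sign : ℝ) ^ k / node N a k ^ s.natAbs * interpSummand N a (l :: t) k := by
  cases t <;>
  · simp only [interpSummand, natAbs_signedAdd, sign_signedAdd hs hl]
    push_cast
    rw [mul_pow, pow_add, ← mul_assoc, div_mul_div_comm]

/-- Expanding the interpolated sum over the choices of commas and pluses. -/
lemma sum_interpSummand (t : List ℤ) : ∀ (s : ℤ), s ≠ 0 → (∀ l ∈ t, l ≠ 0) → ∀ n,
    ∑ k ∈ Finset.range n, interpSummand N a (s :: t) k =
      2 ^ t.length * ((plusCommaChoices s t).map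
        (fun p => (1 / 2 : ℝ) ^ p.1 * tTildeFin N a p.2 n)).sum := by
  induction t with
  | nil => intro s _ _ n; simp [plusCommaChoices, interpSummand, tTildeFin_singleton]
  | cons l t ih =>
    intro s hs hl n
    have hl0 : l ≠ 0 := hl l (by simp)
    have ht : ∀ l ∈ t, l ≠ 0 := fun x hx => hl x (by simp [hx])
    have hsl : signedAdd s l ≠ 0 := by
      have := natAbs_signedAdd s l
      omega
    have comma : ∑ k ∈ Finset.range n, (s.sign : ℝ) ^ k / node N a k ^ s.natAbs *
        ∑ j ∈ Finset.range k, interpSummand N a (l :: t) j =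
        2 ^ t.length * ((plusCommaChoices l t).map
          (fun p => (1 / 2 : ℝ) ^ p.1 * tTildeFin N a (s :: p.2) n)).sum := by
      have : ∀ p ∈ plusCommaChoices l t, (1 / 2 : ℝ) ^ p.1 * tTildeFin N a (s :: p.2) n =
          ∑ k ∈ Finset.range n, (s.sign : ℝ) ^ k / node N a k ^ s.natAbs *
            ((1 / 2 : ℝ) ^ p.1 * tTildeFin N a p.2 k) := by
        intro p hp
        rw [tTildeFin_cons _ (plusCommaChoices_ne_nil t l p hp), Finset.mul_sum]
        exact Finset.sum_congr rfl fun k _ => by ring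
      rw [List.map_congr_left this]
      have swap : ∀ (L : List (ℕ × List ℤ)) (f : ℕ × List ℤ → ℕ → ℝ),
          (L.map fun p => ∑ k ∈ Finset.range n, (s.sign : ℝ) ^ k / node N a k ^ s.natAbs *
            f p k).sum = ∑ k ∈ Finset.range n, (s.sign : ℝ) ^ k / node N a k ^ s.natAbs *
              (L.map fun p => f p k).sum := by
        intro L f
        induction L with
        | nil => simp
        | cons p L ihL => simp [ihL, mul_add, Finset.sum_add_distrib]
      rw [swap _ fun p k => (1 / 2 : ℝ) ^ p.1 * tTildeFin N a p.2 k, Finset.mul_sum]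
      refine Finset.sum_congr rfl fun k _ => ?_
      rw [ih l hl0 ht k]; ring
    have plus := ih (signedAdd s l) hsl ht n
    simp only [interpSummand_signedAdd hs hl0] at plus
    have half : ((plusCommaChoices (signedAdd s l) t).map
        (fun p => (1 / 2 : ℝ) ^ (p.1 + 1) * tTildeFin N a p.2 n)).sum =
        1 / 2 * ((plusCommaChoices (signedAdd s l) t).map
          (fun p => (1 / 2 : ℝ) ^ p.1 * tTildeFin N a p.2 n)).sum := by
      rw [← List.sum_map_mul_left]
      congr 2
      funext p
      ring
    simp only [plusCommaChoices, List.map_append, List.map_map, List.sum_append,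
      Function.comp_def, interpSummand, List.length_cons, mul_add, Finset.sum_add_distrib]
    rw [half, plus]
    simp only [mul_left_comm _ (2 : ℝ), ← Finset.mul_sum]
    rw [comma]
    ring

/-! ### The star sums attached to the pattern `3, 1` -/

lemma tStarFin_cons (s : ℕ) (t : List ℕ) :
    tStarFin N a (s :: t) = fun n => ∑ m ∈ Finset.range (n + 1),
      1 / node N a m ^ s * tStarFin N a t m := by
  funext n; simp only [tStarFin, node]

lemma isTransform_replicate_two (ha : 1 ≤ a) (haN : a ≤ N) {t : List ℕ} {g : ℕ → ℝ}
    (H : IsTransform N a (tStarFin N a t) g) (c : ℕ) :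
    IsTransform N a (tStarFin N a (List.replicate c 2 ++ t))
      (fun k => g k / node N a k ^ (2 * c)) := by
  induction c with
  | zero => simpa using H
  | succ c ih =>
    rw [List.replicate_succ, List.cons_append, tStarFin_cons]
    convert isTransform_weight_two ha haN ih using 2 with k
    rw [div_div, ← pow_add]; rfl

lemma blocksOfTwos_pattern31_succ (d : ℕ) (b : ℕ → ℕ) :
    blocksOfTwos (pattern31 (d + 1)) b = List.replicate (b 0) 2 ++ 3 ::
      (List.replicate (b 1) 2 ++ 1 :: blocksOfTwos (pattern31 d) (fun i => b (i + 2))) := by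
  simp [pattern31, List.replicate_succ, blocksOfTwos]

lemma barIndex31_succ (d : ℕ) (b : ℕ → ℕ) :
    barIndex31 (d + 1) b = -(2 * (b 0 : ℤ) + 2) :: -(2 * (b 1 : ℤ) + 2) ::
      barIndex31 d (fun i => b (i + 2)) := by
  simp [barIndex31, mul_add, List.range_succ_eq_map, Function.comp_def]

lemma barIndex31_ne_nil (d : ℕ) (b : ℕ → ℕ) : barIndex31 d b ≠ [] := by simp [barIndex31]

lemma interpSummand_cons (s : ℤ) {q : List ℤ} (hq : q ≠ []) (k : ℕ) :
    interpSummand N a (s :: q) k = (s.sign : ℝ) ^ k / node N a k ^ s.natAbs *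
      (interpSummand N a q k + 2 * ∑ j ∈ Finset.range k, interpSummand N a q j) := by
  cases q with
  | nil => exact absurd rfl hq
  | cons l t => rw [interpSummand]

lemma sign_neg_bar (c e : ℕ) : ((-(2 * (c : ℤ) + (e + 1 : ℕ))).sign : ℝ) = -1 := by
  rw [Int.sign_eq_neg_one_of_neg (by omega)]; simp

/-- The finite form of the theorem, for every truncation of the star sum. -/
theorem isTransform_pattern31 (ha : 1 ≤ a) (haN : a ≤ N) (d : ℕ) : ∀ b : ℕ → ℕ,
    IsTransform N a (tStarFin N a (blocksOfTwos (pattern31 d) b))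
      (interpSummand N a (barIndex31 d b)) := by
  induction d with
  | zero =>
    intro b
    have H : IsTransform N a (tStarFin N a []) _ := isTransform_one ha haN
    convert isTransform_replicate_two ha haN H (b 0) using 1
    · simp [pattern31, blocksOfTwos]
    · funext k
      have h1 := sign_neg_bar (b 0) 0
      have h2 : (-(2 * (b 0 : ℤ) + 1)).natAbs = 2 * b 0 + 1 := by omega
      simp only [zero_add, Nat.cast_one] at h1
      simp only [barIndex31, mul_zero, List.range_zero, List.map_nil, List.nil_append,
        interpSummand, h1, h2]
      rw [pow_succ]
      field_simp
  | succ d ih =>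
    intro b
    have H1 := isTransform_weight_one ha haN (ih fun i => b (i + 2))
    rw [← tStarFin_cons] at H1
    have H2 := isTransform_replicate_two ha haN H1 (b 1)
    have hne := barIndex31_ne_nil d fun i => b (i + 2)
    have habs : ∀ c : ℕ, (-(2 * (c : ℤ) + 2)).natAbs = 2 * c + 2 := by intro c; omega
    have hsgn : ∀ c : ℕ, ((-(2 * (c : ℤ) + 2)).sign : ℝ) = -1 := fun c => by
      simpa using sign_neg_bar c 1
    have H3 := isTransform_weight_three ha haN H2
      (v := interpSummand N a (-(2 * (b 1 : ℤ) + 2) :: barIndex31 d fun i => b (i + 2))) <| by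
        intro k
        have hk := node_pos (N := N) ha k
        rw [interpSummand_cons _ hne, habs, hsgn]
        field_simp
        ring
    rw [← tStarFin_cons] at H3
    have H4 := isTransform_replicate_two ha haN H3 (b 0)
    rw [blocksOfTwos_pattern31_succ, barIndex31_succ]
    convert H4 using 2 with k
    have hk := node_pos (N := N) ha k
    rw [interpSummand_cons _ (by simp), habs, hsgn]
    field_simp
    ring

/-! ### Limits of the kernel -/

lemma pochRatio_pos (ha : 1 ≤ a) (haN : a ≤ N) (k : ℕ) : 0 < pochRatio N a k := by
  have hN : (0 : ℝ) < N := by exact_mod_cast ha.trans haN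
  have ha' : (0 : ℝ) < a := by exact_mod_cast ha
  induction k with
  | zero => simp [pochRatio]
  | succ k ih => rw [pochRatio_succ]; positivity

lemma pochRatio_le (ha : 1 ≤ a) (haN : a ≤ N) (k : ℕ) : pochRatio N a k ≤ k + 1 := by
  have hN : (0 : ℝ) < N := by exact_mod_cast ha.trans haN
  have h2 : 2 * (a : ℝ) / N ≤ 2 := by
    rw [div_le_iff₀ hN]
    have : (a : ℝ) ≤ N := by exact_mod_cast haN
    linarith
  induction k with
  | zero => simp [pochRatio]
  | succ k ih =>
    rw [pochRatio_succ, ← mul_div_assoc, div_le_iff₀ (by positivity)]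
    push_cast
    have h3 : 0 ≤ 2 * (a : ℝ) / N + k := by positivity
    nlinarith [mul_le_mul_of_nonneg_right ih h3]

lemma pochRatio_mul_GammaSeq (ha : 1 ≤ a) (haN : a ≤ N) (n : ℕ) :
    pochRatio N a n * (2 * (a : ℝ) / N + n) * Real.GammaSeq (2 * (a : ℝ) / N) n =
      (n : ℝ) ^ (2 * (a : ℝ) / N) := by
  have hN : (0 : ℝ) < N := by exact_mod_cast ha.trans haN
  have ha' : (0 : ℝ) < a := by exact_mod_cast ha
  have h : ∀ n, pochRatio N a n * (n.factorial : ℝ) =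
      ∏ j ∈ Finset.range n, (2 * (a : ℝ) / N + j) := by
    intro n
    induction n with
    | zero => simp [pochRatio]
    | succ n ih =>
      rw [Finset.prod_range_succ, ← ih, pochRatio_succ, Nat.factorial_succ]
      push_cast
      field_simp
  have hp : 0 < pochRatio N a n := pochRatio_pos ha haN n
  have hf : (0 : ℝ) < n.factorial := by positivity
  have hz : 0 < 2 * (a : ℝ) / N + n := by positivity
  rw [Real.GammaSeq, Finset.prod_range_succ, ← h]
  field_simp

/-- The case `a = N` has to be excluded here: then the quotient is constant. -/
lemma tendsto_pochRatio_div_node (ha : 1 ≤ a) (haN : a < N) :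
    Tendsto (fun n => pochRatio N a n / node N a n) atTop (𝓝 0) := by
  have hN : (0 : ℝ) < N := by exact_mod_cast ha.trans haN.le
  have ha' : (0 : ℝ) < a := by exact_mod_cast ha
  set z := 2 * (a : ℝ) / N with hz
  have hz0 : 0 < z := by positivity
  have hz2 : 0 < 2 - z := by
    have : z < 2 := by
      rw [hz, div_lt_iff₀ hN]
      have : (a : ℝ) < N := by exact_mod_cast haN
      linarith
    linarith
  have h1 : Tendsto (fun n : ℕ => (n : ℝ) ^ (-(2 - z))) atTop (𝓝 0) :=
    (tendsto_rpow_neg_atTop hz2).comp tendsto_natCast_atTop_atTop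
  have h2 := (Real.GammaSeq_tendsto_Gamma z).inv₀ (Real.Gamma_pos_of_pos hz0).ne'
  have h3 := tendsto_natCast_div_add_atTop z
  have h4 := (tendsto_natCast_div_add_atTop ((a : ℝ) / N)).div_const (N : ℝ)
  have h := ((h1.mul h2).mul h3).mul h4
  simp only [zero_mul] at h
  refine h.congr' ?_
  filter_upwards [eventually_ge_atTop 1] with n hn
  have hn' : (0 : ℝ) < n := by exact_mod_cast hn
  have e := pochRatio_mul_GammaSeq ha haN.le n
  rw [← hz] at e
  have hg : Real.GammaSeq z n ≠ 0 := by
    intro h0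
    rw [h0, mul_zero] at e
    exact (Real.rpow_pos_of_pos hn' z).ne e
  have hzn : 0 < n + z := by positivity
  have e' : (n : ℝ) ^ (-(2 - z)) = pochRatio N a n * (z + n) * Real.GammaSeq z n / n ^ 2 := by
    rw [e, neg_sub, Real.rpow_sub hn']; norm_num
  have hx : node N a n = N * (n + (a : ℝ) / N) := by unfold node; field_simp
  have hx0 : 0 < (n : ℝ) + (a : ℝ) / N := by positivity
  rw [e', hx, add_comm z]
  set y := (n : ℝ) + (a : ℝ) / N
  field_simp

lemma tendsto_kernelConst (ha : 1 ≤ a) (haN : a ≤ N) :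
    Tendsto (kernelConst N a) atTop (𝓝 (2 / ProbabilityTheory.beta ((a : ℝ) / N) ((a : ℝ) / N))) := by
  have hN : (0 : ℝ) < N := by exact_mod_cast ha.trans haN
  have ha' : (0 : ℝ) < a := by exact_mod_cast ha
  have hα : 0 < (a : ℝ) / N := by positivity
  have h1 := Real.GammaSeq_tendsto_Gamma ((a : ℝ) / N)
  have h2 := Real.GammaSeq_tendsto_Gamma (2 * (a : ℝ) / N)
  have h := (h2.const_mul 2).div (h1.pow 2) (pow_pos (Real.Gamma_pos_of_pos hα) 2).ne'
  have e : 2 / ProbabilityTheory.beta ((a : ℝ) / N) ((a : ℝ) / N) =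
      2 * Real.Gamma (2 * (a : ℝ) / N) / Real.Gamma ((a : ℝ) / N) ^ 2 := by
    rw [ProbabilityTheory.beta, show (a : ℝ) / N + (a : ℝ) / N = 2 * (a : ℝ) / N by ring]
    have := Real.Gamma_pos_of_pos hα
    have := Real.Gamma_pos_of_pos (show 0 < 2 * (a : ℝ) / N by positivity)
    field_simp
  rw [e]
  refine h.congr' ?_
  filter_upwards [eventually_ge_atTop 1] with n hn
  have hn' : (0 : ℝ) < n := by exact_mod_cast hn
  have hP : 0 < ∏ i ∈ Finset.range (n + 1), ((a : ℝ) / N + i) :=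
    Finset.prod_pos fun i _ => by positivity
  have hQ : 0 < ∏ i ∈ Finset.range (n + 1), (2 * (a : ℝ) / N + i) :=
    Finset.prod_pos fun i _ => by positivity
  have hf : (0 : ℝ) < n.factorial := by positivity
  have hpow : (n : ℝ) ^ (2 * (a : ℝ) / N) = ((n : ℝ) ^ ((a : ℝ) / N)) ^ 2 := by
    rw [show 2 * (a : ℝ) / N = (a : ℝ) / N * (2 : ℕ) by push_cast; ring,
      Real.rpow_mul_natCast hn'.le]
  have hr := Real.rpow_pos_of_pos hn' ((a : ℝ) / N)
  simp only [Real.GammaSeq, kernelConst, hpow, Pi.div_apply]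
  set R := (n : ℝ) ^ ((a : ℝ) / N)
  set P := ∏ i ∈ Finset.range (n + 1), ((a : ℝ) / N + i)
  set Q := ∏ i ∈ Finset.range (n + 1), (2 * (a : ℝ) / N + i)
  field_simp

lemma tendsto_kernelRatio (k : ℕ) :
    Tendsto (fun n => kernelRatio N a n k) atTop (𝓝 1) := by
  have hz : 0 ≤ 2 * (a : ℝ) / N := by positivity
  have : Tendsto (fun n => kernelRatio N a n k) atTop (𝓝 (∏ i ∈ Finset.range k, 1)) := by
    unfold kernelRatio
    refine tendsto_finsetProd _ fun i _ => ?_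
    set w := 2 * (a : ℝ) / N + 1 + i with hw
    have h1 := tendsto_natCast_div_add_atTop (𝕜 := ℝ) w
    have h2 : Tendsto (fun n : ℕ => (i : ℝ) / ((n : ℝ) + w)) atTop (𝓝 0) :=
      tendsto_const_nhds.div_atTop
        (tendsto_atTop_add_const_right _ _ tendsto_natCast_atTop_atTop)
    have h := h1.sub h2
    rw [sub_zero] at h
    refine h.congr fun n => ?_
    rw [← sub_div, hw]
    congr 1
    ring
  simpa using this

lemma kernelRatio_nonneg (n k : ℕ) : 0 ≤ kernelRatio N a n k := by
  rcases lt_or_ge n k with h | h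
  · rw [kernelRatio_eq_zero h]
  · refine Finset.prod_nonneg fun i hi => ?_
    have : (i : ℝ) ≤ n := by exact_mod_cast (Finset.mem_range.1 hi).le.trans h
    have : 0 ≤ (n : ℝ) - i := by linarith
    positivity

lemma kernelRatio_succ_le (ha : 1 ≤ a) (n k : ℕ) :
    kernelRatio N a n (k + 1) ≤ kernelRatio N a n k := by
  have h0 := kernelRatio_nonneg (N := N) (a := a) n k
  have h : (0 : ℝ) < 2 * (a : ℝ) / N + n + 1 + k := by positivity
  have h3 : (0 : ℝ) ≤ 2 * (a : ℝ) / N := by positivity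
  rw [kernelRatio_succ]
  refine mul_le_of_le_one_right h0 ?_
  rw [div_le_one h]
  have : (0 : ℝ) ≤ k := by positivity
  linarith

/-! ### Summation with decreasing weights -/

/-- If the weights `K n k` decrease in `k` from `1` to `0` and tend to `1` as `n → ∞`, then the
weighted sums of `g` converge to the (possibly conditionally convergent) sum of `g`. -/
lemma tendsto_weighted_sum {K : ℕ → ℕ → ℝ} {g : ℕ → ℝ} {L : ℝ}
    (K_zero : ∀ n, K n 0 = 1) (K_top : ∀ n, K n (n + 1) = 0)
    (K_anti : ∀ n k, K n (k + 1) ≤ K n k) (K_lim : ∀ k, Tendsto (fun n => K n k) atTop (𝓝 1))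
    (hg : Tendsto (fun n => ∑ k ∈ Finset.range n, g k) atTop (𝓝 L)) :
    Tendsto (fun n => ∑ k ∈ Finset.range (n + 1), K n k * g k) atTop (𝓝 L) := by
  set G : ℕ → ℝ := fun n => ∑ k ∈ Finset.range n, g k with hG
  have abel : ∀ n m, ∑ k ∈ Finset.range m, K n k * g k =
      ∑ k ∈ Finset.range m, (K n k - K n (k + 1)) * (G (k + 1) - L) + K n m * (G m - L) + L := by
    intro n m
    induction m with
    | zero => simp [hG, K_zero]
    | succ m ih =>
      rw [Finset.sum_range_succ, Finset.sum_range_succ, ih]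
      have : G (m + 1) = G m + g m := Finset.sum_range_succ ..
      rw [this]; ring
  obtain ⟨C, hC⟩ : ∃ C, ∀ k, |G k - L| ≤ C := by
    obtain ⟨C, hC⟩ := (hg.sub_const L).abs.bddAbove_range
    exact ⟨C, fun k => hC ⟨k, rfl⟩⟩
  have hC0 : 0 ≤ C := (abs_nonneg _).trans (hC 0)
  rw [Metric.tendsto_atTop]
  intro ε hε
  obtain ⟨M, hM⟩ := Metric.tendsto_atTop.1 hg (ε / 3) (by positivity)
  have hlim : Tendsto (fun n => C * (1 - K n M)) atTop (𝓝 0) := by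
    simpa using ((K_lim M).const_sub 1).const_mul C
  obtain ⟨n₀, hn₀⟩ := eventually_atTop.1 (hlim.eventually_lt_const (show 0 < ε / 3 by positivity))
  refine ⟨max n₀ M, fun n hn => ?_⟩
  have hnM : M ≤ n + 1 := (le_of_max_le_right hn).trans n.le_succ
  rw [abel, K_top, zero_mul, add_zero, Real.dist_eq, add_sub_cancel_right]
  have tele : ∀ m, ∑ k ∈ Finset.range m, (K n k - K n (k + 1)) = 1 - K n m := by
    intro m; rw [Finset.sum_range_sub', K_zero]
  have hd : ∀ k, 0 ≤ K n k - K n (k + 1) := fun k => sub_nonneg.2 (K_anti n k)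
  -- the first `M` terms are small as `K n M → 1`, the others as `G` is close to `L`
  have hterm : ∀ k ∈ Finset.range (n + 1), |(K n k - K n (k + 1)) * (G (k + 1) - L)| ≤
      (if k < M then (K n k - K n (k + 1)) * C else 0) + (K n k - K n (k + 1)) * (ε / 3) := by
    intro k _
    rw [abs_mul, abs_of_nonneg (hd k)]
    split_ifs with h
    · have := mul_le_mul_of_nonneg_left (hC (k + 1)) (hd k)
      have := mul_nonneg (hd k) (show 0 ≤ ε / 3 by positivity)
      linarith
    · have h1 := hM (k + 1) (by omega)
      rw [Real.dist_eq] at h1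
      rw [zero_add]
      exact mul_le_mul_of_nonneg_left h1.le (hd k)
  have hK0 : K n (n + 1) = 0 := K_top n
  calc |∑ k ∈ Finset.range (n + 1), (K n k - K n (k + 1)) * (G (k + 1) - L)|
      ≤ _ := (Finset.abs_sum_le_sum_abs _ _).trans (Finset.sum_le_sum hterm)
    _ = C * (1 - K n M) + ε / 3 := by
        rw [Finset.sum_add_distrib, ← Finset.sum_mul, tele, hK0, ← Finset.sum_filter]
        have : (Finset.range (n + 1)).filter (· < M) = Finset.range M := by
          ext k; simp only [Finset.mem_filter, Finset.mem_range]; omega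
        rw [this, ← Finset.sum_mul, tele]; ring
    _ < ε := by
        have := hn₀ n (le_of_max_le_left hn)
        linarith

/-! ### Convergence of the alternating sums -/

/-- The indices for which the nested sums are bounded: every entry but the last has absolute value
at least `2`, and the last one is `-1` or has absolute value at least `3`. -/
def Admissible : List ℤ → Prop
  | [] => False
  | [s] => s = -1 ∨ 3 ≤ s.natAbs
  | s :: l :: t => 2 ≤ s.natAbs ∧ Admissible (l :: t)

lemma admissible_cons {s : ℤ} {q : List ℤ} (hs : 2 ≤ s.natAbs) (hq : Admissible q) :
    Admissible (s :: q) := by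
  cases q with
  | nil => exact hq.elim
  | cons l t => exact ⟨hs, hq⟩

lemma Admissible.signedAdd {s l : ℤ} {t : List ℤ} (h : Admissible (s :: l :: t)) :
    Admissible (signedAdd s l :: t) := by
  have hs := h.1
  have e := natAbs_signedAdd s l
  cases t with
  | nil => rcases h.2 with h2 | h2 <;> right <;> omega
  | cons m t => exact ⟨by omega, h.2.2⟩

lemma Admissible.of_mem_plusCommaChoices (t : List ℤ) : ∀ s : ℤ, Admissible (s :: t) →
    ∀ p ∈ plusCommaChoices s t, Admissible p.2 := by
  induction t with
  | nil => intro s h p hp; simp [plusCommaChoices] at hp; simpa [hp] using h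
  | cons l t ih =>
    intro s h p hp
    simp only [plusCommaChoices, List.mem_append, List.mem_map] at hp
    rcases hp with ⟨q, hq, rfl⟩ | ⟨q, hq, rfl⟩
    · exact admissible_cons h.1 (ih l h.2 q hq)
    · exact ih _ h.signedAdd q hq

lemma exists_head_of_mem_plusCommaChoices (t : List ℤ) : ∀ s : ℤ, 2 ≤ s.natAbs →
    ∀ p ∈ plusCommaChoices s t, ∃ s' t', p.2 = s' :: t' ∧ 2 ≤ s'.natAbs := by
  induction t with
  | nil => intro s h p hp; simp [plusCommaChoices] at hp; exact ⟨s, [], by simp [hp], h⟩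
  | cons l t ih =>
    intro s h p hp
    simp only [plusCommaChoices, List.mem_append, List.mem_map] at hp
    rcases hp with ⟨q, hq, rfl⟩ | ⟨q, hq, rfl⟩
    · exact ⟨s, q.2, rfl, h⟩
    · exact ih _ (by rw [natAbs_signedAdd]; omega) q hq

lemma succ_le_node (ha : 1 ≤ a) (haN : a ≤ N) (k : ℕ) : (k : ℝ) + 1 ≤ node N a k := by
  have h : k + 1 ≤ N * k + a := by nlinarith
  unfold node
  exact_mod_cast h

lemma abs_sign_pow_le (s : ℤ) (k : ℕ) : |(s.sign : ℝ) ^ k| ≤ 1 := by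
  rw [abs_pow]
  refine pow_le_one₀ (abs_nonneg _) ?_
  rcases Int.sign_trichotomy s with h | h | h <;> simp [h]

lemma tendsto_sum_of_le_inv_sq {f : ℕ → ℝ} {C : ℝ} (hf : ∀ k, |f k| ≤ C * (1 / ((k : ℝ) + 1) ^ 2)) :
    ∃ L, Tendsto (fun n => ∑ k ∈ Finset.range n, f k) atTop (𝓝 L) := by
  have h1 : Summable fun k : ℕ => 1 / ((k : ℝ) + 1) ^ 2 := by
    have := (summable_nat_add_iff 1).2 (Real.summable_one_div_nat_pow.2 one_lt_two)
    simpa using this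
  exact ⟨_, (Summable.of_norm_bounded (h1.mul_left C) hf).hasSum.tendsto_sum_nat⟩

lemma exists_abs_le_of_tendsto {u : ℕ → ℝ} (h : ∃ L, Tendsto u atTop (𝓝 L)) :
    ∃ C, ∀ n, |u n| ≤ C := by
  obtain ⟨L, hL⟩ := h
  obtain ⟨C, hC⟩ := hL.abs.bddAbove_range
  exact ⟨C, fun n => hC ⟨n, rfl⟩⟩

lemma tTildeConverges_cons (ha : 1 ≤ a) (haN : a ≤ N) {s : ℤ} (hs : 2 ≤ s.natAbs) {q : List ℤ}
    (hq : q ≠ []) (hb : ∃ C, ∀ n, |tTildeFin N a q n| ≤ C) : TTildeConverges N a (s :: q) := by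
  obtain ⟨C, hC⟩ := hb
  have := tendsto_sum_of_le_inv_sq (C := C) (f := fun k =>
    (s.sign : ℝ) ^ k / node N a k ^ s.natAbs * tTildeFin N a q k) <| by
      intro k
      have hx := succ_le_node ha haN k
      have hk : (0 : ℝ) ≤ k := by positivity
      have h1 : ((k : ℝ) + 1) ^ 2 ≤ node N a k ^ s.natAbs :=
        (pow_le_pow_left₀ (by positivity) hx 2).trans (pow_le_pow_right₀ (by linarith) hs)
      have hp := node_pos (N := N) ha k
      rw [abs_mul, abs_div, abs_of_pos (pow_pos hp _), mul_comm]
      refine mul_le_mul (hC k) ?_ (by positivity) ((abs_nonneg _).trans (hC k))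
      exact div_le_div₀ zero_le_one (abs_sign_pow_le s k) (by positivity) h1
  unfold TTildeConverges
  convert this using 3 with L
  funext n
  exact tTildeFin_cons s hq n

lemma tTildeConverges_singleton (ha : 1 ≤ a) (haN : a ≤ N) {s : ℤ} (hs : 3 ≤ s.natAbs) :
    TTildeConverges N a [s] := by
  have := tendsto_sum_of_le_inv_sq (C := 1) (f := fun k =>
    (s.sign : ℝ) ^ k / node N a k ^ s.natAbs * pochRatio N a k) <| by
      intro k
      have hx := succ_le_node ha haN k
      have hk : (0 : ℝ) ≤ k := by positivity
      have h1 : ((k : ℝ) + 1) ^ 3 ≤ node N a k ^ s.natAbs :=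
        (pow_le_pow_left₀ (by positivity) hx 3).trans (pow_le_pow_right₀ (by linarith) hs)
      have hp := node_pos (N := N) ha k
      have hq := pochRatio_pos ha haN k
      rw [abs_mul, abs_div, abs_of_pos (pow_pos hp _), abs_of_pos hq]
      calc _ ≤ 1 / ((k : ℝ) + 1) ^ 3 * (k + 1) := by
            refine mul_le_mul ?_ (pochRatio_le ha haN k) hq.le (by positivity)
            exact div_le_div₀ zero_le_one (abs_sign_pow_le s k) (by positivity) h1
        _ = _ := by field_simp
  unfold TTildeConverges
  convert this using 3 with L
  funext n
  exact tTildeFin_singleton s n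

lemma alternating_sum_bounds (n : ℕ) : ∀ u : ℕ → ℝ, Antitone u → (∀ k, 0 ≤ u k) →
    0 ≤ ∑ k ∈ Finset.range n, (-1) ^ k * u k ∧ ∑ k ∈ Finset.range n, (-1) ^ k * u k ≤ u 0 := by
  induction n with
  | zero => intro u _ h; simp [h]
  | succ n ih =>
    intro u hu h
    have h1 := ih (fun k => u (k + 1)) (fun i j hij => hu (Nat.succ_le_succ hij)) fun k => h _
    have e : ∑ k ∈ Finset.range (n + 1), (-1) ^ k * u k =
        u 0 - ∑ k ∈ Finset.range n, (-1) ^ k * u (k + 1) := by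
      rw [Finset.sum_range_succ']
      simp only [pow_succ, mul_neg, mul_one, neg_mul, Finset.sum_neg_distrib, pow_zero, one_mul]
      ring
    have h2 : u (0 + 1) ≤ u 0 := hu (Nat.zero_le _)
    rw [e]
    constructor <;> linarith [h1.1, h1.2]

lemma antitone_pochRatio_div_node (ha : 1 ≤ a) (haN : a ≤ N) :
    Antitone fun k => pochRatio N a k / node N a k := by
  refine antitone_nat_of_succ_le fun k => ?_
  have hN : (0 : ℝ) < N := by exact_mod_cast ha.trans haN
  have ha' : (0 : ℝ) < a := by exact_mod_cast ha
  have haN' : (a : ℝ) ≤ N := by exact_mod_cast haN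
  have hq := pochRatio_pos ha haN k
  have h1 := node_pos (N := N) ha k
  have h2 := node_pos (N := N) ha (k + 1)
  have key : (2 * (a : ℝ) / N + k) * node N a k ≤ (k + 1) * node N a (k + 1) := by
    have e : 2 * (a : ℝ) / N * N = 2 * a := by field_simp
    have h3 : 2 * (a : ℝ) / N ≤ 2 := by rw [div_le_iff₀ hN]; linarith
    have hk : (0 : ℝ) ≤ k := by positivity
    unfold node
    push_cast
    nlinarith [mul_le_mul_of_nonneg_right h3 ha'.le, mul_nonneg hk (sub_nonneg.2 haN')]
  rw [pochRatio_succ, div_le_div_iff₀ h2 h1, ← mul_div_assoc, div_mul_eq_mul_div,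
    div_le_iff₀ (by positivity)]
  nlinarith [mul_le_mul_of_nonneg_left key hq.le]

lemma tTildeFin_neg_one (n : ℕ) : tTildeFin N a [-1] n =
    ∑ k ∈ Finset.range n, (-1) ^ k * (pochRatio N a k / node N a k) := by
  rw [tTildeFin_singleton]
  refine Finset.sum_congr rfl fun k _ => ?_
  simp
  ring

lemma Admissible.bounded (ha : 1 ≤ a) (haN : a ≤ N) : ∀ {q : List ℤ}, Admissible q →
    ∃ C, ∀ n, |tTildeFin N a q n| ≤ C
  | [], h => h.elim
  | [s], h => by
    rcases h with rfl | h
    · refine ⟨pochRatio N a 0 / node N a 0, fun n => ?_⟩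
      have := alternating_sum_bounds n _ (antitone_pochRatio_div_node ha haN)
        fun k => (div_pos (pochRatio_pos ha haN k) (node_pos ha k)).le
      rw [tTildeFin_neg_one, abs_of_nonneg this.1]
      exact this.2
    · exact exists_abs_le_of_tendsto (tTildeConverges_singleton ha haN h)
  | s :: l :: t, h => exists_abs_le_of_tendsto
      (tTildeConverges_cons ha haN h.1 (by simp) (Admissible.bounded ha haN h.2))

lemma Admissible.converges (ha : 1 ≤ a) (haN : a ≤ N) {s : ℤ} {t : List ℤ}
    (h : Admissible (s :: t)) (hs : 2 ≤ s.natAbs) : TTildeConverges N a (s :: t) := by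
  cases t with
  | nil => exact tTildeConverges_singleton ha haN (h.resolve_left (by rintro rfl; simp at hs))
  | cons l t => exact tTildeConverges_cons ha haN hs (by simp) (h.2.bounded ha haN)

lemma tTildeConverges_neg_one (ha : 1 ≤ a) (haN : a < N) : TTildeConverges N a [-1] := by
  have := (antitone_pochRatio_div_node ha haN.le).tendsto_alternating_series_of_tendsto_zero
    (tendsto_pochRatio_div_node ha haN)
  unfold TTildeConverges
  rw [funext tTildeFin_neg_one]
  exact this

lemma admissible_barIndex31 (d : ℕ) : ∀ b : ℕ → ℕ, Admissible (barIndex31 d b) := by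
  induction d with
  | zero => intro b; simp [barIndex31, Admissible]; omega
  | succ d ih =>
    intro b
    rw [barIndex31_succ]
    exact admissible_cons (by omega) (admissible_cons (by omega) (ih _))

lemma tTildeInterpConverges_barIndex31 (ha : 1 ≤ a) (haN : a ≤ N) (d : ℕ) (b : ℕ → ℕ)
    (hconv : ¬ (d = 0 ∧ b 0 = 0 ∧ a = N)) : TTildeInterpConverges N a (barIndex31 d b) := by
  have big : ∀ s t, barIndex31 d b = s :: t → 2 ≤ s.natAbs →
      TTildeInterpConverges N a (barIndex31 d b) := by
    intro s t h hs p hp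
    have had := admissible_barIndex31 d b
    rw [h] at hp had
    have hp' := had.of_mem_plusCommaChoices t s p hp
    obtain ⟨s', t', e, hs'⟩ := exists_head_of_mem_plusCommaChoices t s hs p hp
    rw [e] at hp' ⊢
    exact hp'.converges ha haN hs'
  cases d with
  | succ d => exact big _ _ (barIndex31_succ d b) (by omega)
  | zero =>
    have e : barIndex31 0 b = [-(2 * (b 0 : ℤ) + 1)] := by simp [barIndex31]
    by_cases hb : b 0 = 0
    · intro p hp
      rw [e] at hp
      simp [indexChoices, plusCommaChoices, hb] at hp
      rw [hp]
      exact tTildeConverges_neg_one ha (lt_of_le_of_ne haN fun h => hconv ⟨rfl, hb, h⟩)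
    · exact big _ _ e (by omega)

lemma ne_zero_of_mem_barIndex31 (d : ℕ) (b : ℕ → ℕ) : ∀ s ∈ barIndex31 d b, s ≠ 0 := by
  intro s hs
  simp only [barIndex31, List.mem_append, List.mem_map, List.mem_singleton] at hs
  rcases hs with ⟨i, _, rfl⟩ | rfl <;> omega

lemma tendsto_sum_interpSummand {q : List ℤ} (hq : ∀ s ∈ q, s ≠ 0) (hne : q ≠ [])
    (h : TTildeInterpConverges N a q) :
    Tendsto (fun n => ∑ k ∈ Finset.range n, interpSummand N a q k) atTop
      (𝓝 (2 ^ (q.length - 1) * tTildeInterp N a (1 / 2) q)) := by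
  cases q with
  | nil => exact absurd rfl hne
  | cons s t =>
    rw [funext (sum_interpSummand t s (hq s (by simp)) fun l hl => hq l (by simp [hl]))]
    refine Tendsto.const_mul _ ?_
    refine tendsto_list_sum _ fun p hp => ?_
    exact (tendsto_nhds_limUnder (h p hp)).const_mul _

end MultipleT

theorem mainTheorem11 (N a : ℕ) (ha : 1 ≤ a) (haN : a ≤ N) (d : ℕ) (b : ℕ → ℕ)
    (hconv : ¬ (d = 0 ∧ b 0 = 0 ∧ a = N)) :
    TStarConverges N a (blocksOfTwos (pattern31 d) b) ∧
    TTildeInterpConverges N a (barIndex31 d b) ∧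
    tStar N a (blocksOfTwos (pattern31 d) b) =
      2 ^ (2 * d + 1) * (N : ℝ) / ProbabilityTheory.beta ((a : ℝ) / N) ((a : ℝ) / N) *
        tTildeInterp N a (1 / 2) (barIndex31 d b) := by
  have hT := MultipleT.tTildeInterpConverges_barIndex31 ha haN d b hconv
  have h1 := MultipleT.tendsto_sum_interpSummand (MultipleT.ne_zero_of_mem_barIndex31 d b)
    (MultipleT.barIndex31_ne_nil d b) hT
  have h2 := MultipleT.tendsto_weighted_sum (K := MultipleT.kernelRatio N a)
    (fun n => by simp [MultipleT.kernelRatio])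
    (fun n => MultipleT.kernelRatio_eq_zero n.lt_succ_self)
    (MultipleT.kernelRatio_succ_le ha) MultipleT.tendsto_kernelRatio h1
  have h3 := ((MultipleT.tendsto_kernelConst ha haN).const_mul (N : ℝ)).mul h2
  have h4 : Tendsto (tStarFin N a (blocksOfTwos (pattern31 d) b)) atTop
      (𝓝 (2 ^ (2 * d + 1) * (N : ℝ) / ProbabilityTheory.beta ((a : ℝ) / N) ((a : ℝ) / N) *
        tTildeInterp N a (1 / 2) (barIndex31 d b))) := by
    convert h3 using 1
    · funext n
      rw [MultipleT.isTransform_pattern31 ha haN d b n, Finset.mul_sum]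
      exact Finset.sum_congr rfl fun k _ => by rw [MultipleT.kernel, mul_assoc]
    · have : (barIndex31 d b).length - 1 = 2 * d := by simp [barIndex31]
      rw [this, pow_succ]
      congr 1
      ring
  exact ⟨⟨_, h4⟩, hT, h4.limUnder_eq⟩
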